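/- **Theorem (enriched small object argument).** Let $\mathcal V$ be a cosmos, i.e. a complete and cocomplete symmetric monoidal closed category with underlying category $\mathcal V_0$, let $\mathcal K$ be a $\mathcal V$-category, and let $\mathcal K_0$ be its underlying category. "Small" and "set" refer to a universe in which $\mathcal V_0$ and $\mathcal K_0$ are locally small. *Conventions.* A colimit in the $\mathcal V$-category $\mathcal K$ is a colimit in $\mathcal K_0$ which every representable functor $\mathcal K(-,X)\colon \mathcal K_0^{\mathrm{op}}\to\mathcal V_0$ sends to a limit in $\mathcal V_0$. The category $\mathcal K$ has transfinite composites if the colimit in $\mathcal K$ exists for every functor $A$ from a nonempty small well-ordered set to $\mathcal K_0$ such that, for each limit element $\gamma$, $A_\gamma$ is the colimit in $\mathcal K$ of the $A_\delta$, $\delta<\gamma$. It is copowered if for all $U\in\mathcal V$ and $A\in\mathcal K$ there is an object $U\odot A$ with isomorphisms $\mathcal K(U\odot A,B)\cong[U,\mathcal K(A,B)]$ that are $\mathcal V$-natural in $B$. An object $X$ of $\mathcal K$ is presentable in the enriched sense if for some (small) regular cardinal $\lambda$ the functor $\mathcal K(X,-)\colon\mathcal K_0\to\mathcal V_0$ preserves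 $\lambda$-directed colimits in $\mathcal K$. A class $\mathscr S$ of morphisms of $\mathcal V_0$ is stable under corners if for all $s\colon A\to B$ and $t\colon X\to Y$ in $\mathscr S$ the induced morphism $\nabla(s,t)\colon (B\otimes X)\sqcup_{A\otimes X}(A\otimes Y)\to B\otimes Y$ is in $\mathscr S$. For $f\colon A\to B$ and $k\colon C\to D$ in $\mathcal K_0$ let $\mathrm{Sq}(f,k)$ be the pullback in $\mathcal V_0$ of $\mathcal K(A,k)\colon\mathcal K(A,C)\to\mathcal K(A,D)$ and $\mathcal K(f,D)\colon\mathcal K(B,D)\to\mathcal K(A,D)$, and let $e_{f,k}\colon\mathcal K(B,C)\to\mathrm{Sq}(f,k)$ be the morphism with components $\mathcal K(f,C)$ and $\mathcal K(B,k)$. Given a weak factorization system $\mathscr F=(\mathscr L,\mathscr R)$ on $\mathcal V_0$, write $f\mathrel{\overset{\mathscr F}{\square}}k$ if $e_{f,k}\in\mathscr R$, and for a class $\mathcal C$ of morphisms of $\mathcal K_0$ let $\mathcal C^{\overset{\mathscr F}{\square}}=\{k\mid \forall f\in\mathcal C\colon f\mathrel{\overset{\mathscr F}{\square}}k\}$ and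 ${}^{\overset{\mathscr F}{\square}}\mathcal C=\{f\mid \forall k\in\mathcal C\colon f\mathrel{\overset{\mathscr F}{\square}}k\}$. An enriched weak $\mathscr F$-factorization system on $\mathcal K$ is a pair $(\mathcal L,\mathcal R)$ of classes of morphisms of $\mathcal K_0$ such that every morphism $h$ of $\mathcal K_0$ factors as $h=g\cdot f$ with $f\in\mathcal L$, $g\in\mathcal R$, and $\mathcal L={}^{\overset{\mathscr F}{\square}}\mathcal R$, $\mathcal R=\mathcal L^{\overset{\mathscr F}{\square}}$. *Statement.* Suppose that $\mathcal K$ is copowered and has pushouts and transfinite composites (as a $\mathcal V$-category). Let $\mathcal I$ be a set of morphisms of $\mathcal K_0$, let $\mathcal J$ be a set of morphisms of $\mathcal V_0$, and let $\mathscr F=(\mathscr L,\mathscr R)$ be a weak factorization system on $\mathcal V_0$ that is cofibrantly generated by $\mathcal J$, i.e. $\mathscr R$ is the class of morphisms with the right lifting property with respect to $\mathcal J$. Assume that 1. the domains and codomains of morphisms in $\mathcal I$ are presentable in the enriched sense, 2. the domains and codomains of morphisms in $\mathcal J$ are presentable in $\mathcal V_0$ (in the ordinary sense), and 3. $\mathscr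 L$ is stable under corners. Then every morphism $f$ of $\mathcal K_0$ has a factorization $f=m\cdot e$ with $e\in{}^{\overset{\mathscr F}{\square}}(\mathcal I^{\overset{\mathscr F}{\square}})$ and $m\in\mathcal I^{\overset{\mathscr F}{\square}}$. Consequently $\big({}^{\overset{\mathscr F}{\square}}(\mathcal I^{\overset{\mathscr F}{\square}}),\ \mathcal I^{\overset{\mathscr F}{\square}}\big)$ is an enriched weak $\mathscr F$-factorization system on $\mathcal K$. -/

import Mathlib

open CategoryTheory Limits MonoidalCategory

universe v u u'

namespace EnrichedSmallObject

noncomputable section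

section Colimits

variable (V : Type u) [Category.{v} V] [MonoidalCategory V]
  {C : Type u'} [Category.{v} C] [EnrichedOrdinaryCategory V C]

/-- The representable functor `C(-, X) : C₀ᵒᵖ ⥤ V₀` of a `V`-category `C`. -/
abbrev eYoneda (X : C) : Cᵒᵖ ⥤ V := (eHomFunctor V C).flip.obj X

/-- A cocone in `C₀` is a colimit cocone in the `V`-category `C` if it is a colimit cocone
in `C₀` and each representable functor `C(-, X) : C₀ᵒᵖ ⥤ V₀` sends it to a limit cone. -/
structure IsConicalColimit {J : Type*} [Category* J] {F : J ⥤ C} (c : Cocone F) : Prop where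
  isColimit : Nonempty (IsColimit c)
  isLimit_eYoneda (X : C) : Nonempty (IsLimit ((eYoneda V X).mapCone c.op))

/-- The diagram `F` in `C₀` has a colimit in the `V`-category `C`. -/
def HasConicalColimit {J : Type*} [Category* J] (F : J ⥤ C) : Prop :=
  ∃ c : Cocone F, IsConicalColimit V c

variable (C) in
/-- The `V`-category `C` has pushouts. -/
def HasConicalPushouts : Prop :=
  ∀ F : WalkingSpan ⥤ C, HasConicalColimit V F

/-- A functor `F` from a well-ordered set to `C₀` is a smooth chain in the `V`-category `C`
if for each limit element `j` the object `F j` is the colimit, in the `V`-category `C`,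
of the `F i` with `i < j`. -/
def IsSmoothChain {J : Type v} [LinearOrder J] (F : J ⥤ C) : Prop :=
  ∀ j : J, Order.IsSuccLimit j → IsConicalColimit V ((Set.principalSegIio j).cocone F)

variable (C) in
/-- The `V`-category `C` has transfinite composites: every smooth chain indexed by a nonempty
(small) well-ordered set has a colimit in the `V`-category `C`. -/
def HasTransfiniteComposites : Prop :=
  ∀ (J : Type v) [LinearOrder J] [OrderBot J] [SuccOrder J] [WellFoundedLT J] (F : J ⥤ C),
    IsSmoothChain V F → HasConicalColimit V F

/-- `X` is `κ`-presentable in the enriched sense: the functor `C(X, -) : C₀ ⥤ V₀` preserves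
the `κ`-directed colimits in the `V`-category `C`. -/
def IsEnrichedCardinalPresentable (X : C) (κ : Cardinal.{v}) [Fact κ.IsRegular] : Prop :=
  ∀ (J : Type v) [PartialOrder J] [IsCardinalFiltered J κ] (F : J ⥤ C) (c : Cocone F),
    IsConicalColimit V c → Nonempty (IsColimit ((eCoyoneda V X).mapCocone c))

/-- `X` is presentable in the enriched sense. -/
def IsEnrichedPresentable (X : C) : Prop :=
  ∃ (κ : Cardinal.{v}) (_ : Fact κ.IsRegular), IsEnrichedCardinalPresentable V X κ

end Colimits

section Copowers

variable {V : Type u} [Category.{v} V] [MonoidalCategory V] [MonoidalClosed V]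
  {C : Type u'} [Category.{v} C] [EnrichedOrdinaryCategory V C]

/-- The comparison morphism `C(T, B) ⟶ [U, C(A, B)]` induced by `η : U ⟶ C(A, T)`,
i.e. the transpose of `U ⊗ C(T, B) ⟶ C(A, T) ⊗ C(T, B) ⟶ C(A, B)`. -/
def copowerComparison {U : V} {A T : C} (η : U ⟶ (A ⟶[V] T)) (B : C) :
    (T ⟶[V] B) ⟶ (ihom U).obj (A ⟶[V] B) :=
  MonoidalClosed.curry (η ▷ (T ⟶[V] B) ≫ eComp V A T B)

/-- `T`, with unit `η : U ⟶ C(A, T)`, is the copower `U ⊙ A`: the induced `V`-natural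
transformation `C(T, -) ⟶ [U, C(A, -)]` is an isomorphism. -/
def IsCopower {U : V} {A T : C} (η : U ⟶ (A ⟶[V] T)) : Prop :=
  ∀ B : C, IsIso (copowerComparison η B)

variable (V C) in
/-- The `V`-category `C` is copowered. -/
def IsCopowered : Prop :=
  ∀ (U : V) (A : C), ∃ (T : C) (η : U ⟶ (A ⟶[V] T)), IsCopower η

end Copowers

section Corners

variable {V : Type u} [Category.{v} V] [MonoidalCategory V] [HasPushouts V]

/-- A class of morphisms of `V₀` is stable under corners if it contains the pushout-product
`∇(s, t) : (B ⊗ X) ⨿_{A ⊗ X} (A ⊗ Y) ⟶ B ⊗ Y` of any two of its members `s : A ⟶ B` and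
`t : X ⟶ Y`. -/
def StableUnderCorners (S : MorphismProperty V) : Prop :=
  ∀ ⦃A B X Y : V⦄ (s : A ⟶ B) (t : X ⟶ Y), S s → S t →
    S (pushout.desc (f := s ▷ X) (g := A ◁ t) (B ◁ t) (s ▷ Y) (whisker_exchange s t).symm)

end Corners

section Lifting

variable (V : Type u) [Category.{v} V] [MonoidalCategory V] [HasPullbacks V]
  {C : Type u'} [Category.{v} C] [EnrichedOrdinaryCategory V C]

/-- The object `Sq(f, k)` of squares connecting `f : A ⟶ B` to `k : X ⟶ Y`, i.e. the pullback
of `C(A, k) : C(A, X) ⟶ C(A, Y)` and `C(f, Y) : C(B, Y) ⟶ C(A, Y)`. -/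
abbrev Sq {A B X Y : C} (f : A ⟶ B) (k : X ⟶ Y) : V :=
  pullback (eHomWhiskerLeft V A k) (eHomWhiskerRight V f Y)

/-- The morphism `e_{f,k} : C(B, X) ⟶ Sq(f, k)` with components `C(f, X)` and `C(B, k)`. -/
def toSq {A B X Y : C} (f : A ⟶ B) (k : X ⟶ Y) : (B ⟶[V] X) ⟶ Sq V f k :=
  pullback.lift (eHomWhiskerRight V f X) (eHomWhiskerLeft V B k)
    (eHom_whisker_exchange V f k).symm

variable {V}

/-- For a class `R` of morphisms of `V₀` (the right class of `F = (L, R)`), the `F`-lifting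
property of `f` with respect to `k`: the morphism `e_{f,k}` is in `R`. -/
def HasEnrichedLifting (R : MorphismProperty V) {A B X Y : C} (f : A ⟶ B) (k : X ⟶ Y) : Prop :=
  R (toSq V f k)

/-- The class `I^{F□}` of morphisms of `C₀` with the right `F`-lifting property with respect
to all members of `I`. -/
def enrichedRlp (R : MorphismProperty V) (I : MorphismProperty C) : MorphismProperty C :=
  fun _ _ k => ∀ ⦃A B : C⦄ (f : A ⟶ B), I f → HasEnrichedLifting R f k

/-- The class `^{F□}I` of morphisms of `C₀` with the left `F`-lifting property with respect
to all members of `I`. -/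
def enrichedLlp (R : MorphismProperty V) (I : MorphismProperty C) : MorphismProperty C :=
  fun _ _ f => ∀ ⦃X Y : C⦄ (k : X ⟶ Y), I k → HasEnrichedLifting R f k

/-- `(𝓛, 𝓡)` is an enriched weak `F`-factorization system on `C`, where `R` is the right class
of `F`. -/
structure IsEnrichedWeakFactorizationSystem (R : MorphismProperty V)
    (𝓛 𝓡 : MorphismProperty C) : Prop where
  exists_factorization : ∀ ⦃X Y : C⦄ (h : X ⟶ Y),
    ∃ (Z : C) (f : X ⟶ Z) (g : Z ⟶ Y), 𝓛 f ∧ 𝓡 g ∧ f ≫ g = h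
  left_eq : 𝓛 = enrichedLlp R 𝓡
  right_eq : 𝓡 = enrichedRlp R 𝓛

end Lifting

end

end EnrichedSmallObject

open EnrichedSmallObject

namespace EnrichedSmallObject

noncomputable section

/-! ### Conical colimits through generalized elements -/

section GeneralizedElements

variable (V : Type u) [Category.{v} V] [MonoidalCategory V]
  {C : Type u'} [Category.{v} C] [EnrichedOrdinaryCategory V C]

/-! The enriched factorization comes from an ordinary small object argument in `K₀`. For `i` in `I`
and `j` in `J`, let `c` be the pushout-product of `j` and `i` formed with copowers
(`exists_copowerCorner`), and let `M` be the set of all these `c`. By adjunction, `c` lifts against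
`k` exactly when `j` lifts against `e_{i,k}` (`CopowerCorner.hasLiftingProperty_iff`). Since the
right class is `J.rlp`, this says that `M.rlp` is the enriched right class of `I`.

The argument applies to `M`: an initial object (a copower by the initial object of `V`), pushouts
and transfinite composites give all small colimits, these are conical, and the domains of `M` are
small with respect to them (`CopowerCorner.nonempty_isColimit`). Every morphism thus factors through
`M.rlp.llp` and `M.rlp`.

It remains to see that `M.rlp.llp` lies in the enriched left class. That class is saturated, because
lifting `j` against `e_{f,k}` is a lifting problem for the image of `f` under a cocontinuous functor
(`llp_rlp_le_enrichedLlp`). It contains `M`, because `s` lifts against `e_{c,k}` once `∇(j, s)`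
lifts against `e_{i,k}` (`CopowerCorner.hasLiftingProperty_toSq`), and stability under corners puts
`∇(j, s)` in the left class of `F`. -/

lemma eHomEquiv_comp_whiskerRight {A B Z : C} (f : A ⟶ B) (g : B ⟶ Z) :
    eHomEquiv V g ≫ eHomWhiskerRight V f Z = eHomEquiv V (f ≫ g) := by
  rw [eHomEquiv_comp, eHomWhiskerRight, leftUnitor_inv_naturality_assoc, tensorHom_def',
    Category.assoc]

variable {V}

/-- A cocone is a conical colimit if and only if it has the universal property of a colimit
with respect to generalized elements `U ⟶ C(-, Z)`. -/
lemma isConicalColimit_iff {J : Type*} [Category* J] {F : J ⥤ C} (c : Cocone F) :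
    IsConicalColimit V c ↔ ∀ (U : V) (Z : C) (φ : ∀ j, U ⟶ (F.obj j ⟶[V] Z)),
      (∀ ⦃i j : J⦄ (f : i ⟶ j), φ j ≫ eHomWhiskerRight V (F.map f) Z = φ i) →
      ∃! ψ : U ⟶ (c.pt ⟶[V] Z), ∀ j, ψ ≫ eHomWhiskerRight V (c.ι.app j) Z = φ j := by
  constructor
  · intro h U Z φ hφ
    obtain ⟨hc⟩ := h.isLimit_eYoneda Z
    let s : Cone (F.op ⋙ eYoneda V Z) :=
      { pt := U
        π :=
          { app := fun j => φ j.unop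
            naturality := fun i j f => (Category.id_comp _).trans (hφ f.unop).symm } }
    refine ⟨hc.lift s, fun j => hc.fac s (.op j), fun ψ hψ => hc.uniq s ψ fun j => hψ j.unop⟩
  · intro h
    refine ⟨⟨IsColimit.ofExistsUnique fun s => ?_⟩, fun Z => ⟨IsLimit.ofExistsUnique fun s => ?_⟩⟩
    -- Elements of shape `𝟙_ V` are the morphisms of `C₀`; elements of arbitrary shape give the
    -- limit in `V₀`.
    · obtain ⟨ψ, hψ, hψ'⟩ := h (𝟙_ V) s.pt (fun j => eHomEquiv V (s.ι.app j))
        (fun i j f => by rw [eHomEquiv_comp_whiskerRight, s.w])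
      refine ⟨(eHomEquiv V).symm ψ, fun j => (eHomEquiv V).injective ?_, fun g hg => ?_⟩
      · rw [← eHomEquiv_comp_whiskerRight, Equiv.apply_symm_apply, hψ]
      · rw [Equiv.eq_symm_apply]
        exact hψ' _ fun j => by rw [eHomEquiv_comp_whiskerRight, hg]
    · obtain ⟨ψ, hψ, hψ'⟩ := h s.pt Z (fun j => s.π.app (.op j))
        (fun i j f => s.w f.op)
      exact ⟨ψ, fun j => hψ j.unop, fun g hg => hψ' _ fun j => hg (.op j)⟩

lemma HasConicalColimit.hasColimit {J : Type*} [Category* J] {F : J ⥤ C}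
    (h : HasConicalColimit V F) : HasColimit F :=
  ⟨⟨_, h.choose_spec.isColimit.some⟩⟩

end GeneralizedElements

/-! ### Small coproducts from an initial object, pushouts and transfinite composites -/

section Coproducts

variable (V : Type u) [Category.{v} V] [MonoidalCategory V]
  {C : Type u'} [Category.{v} C] [EnrichedOrdinaryCategory V C]

/-- The morphisms `a i : X i ⟶ c` exhibit `c` as the coproduct of the objects `X i` in the
`V`-category `C`, in terms of generalized elements. -/
def IsConicalCoproduct {ι : Type*} {X : ι → C} {c : C} (a : ∀ i, X i ⟶ c) : Prop :=
  ∀ (U : V) (Z : C) (φ : ∀ i, U ⟶ (X i ⟶[V] Z)),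
    ∃! ψ : U ⟶ (c ⟶[V] Z), ∀ i, ψ ≫ eHomWhiskerRight V (a i) Z = φ i

/-- The coproduct of the objects `X i` exists in the `V`-category `C`. -/
def HasConicalCoproduct {ι : Type*} (X : ι → C) : Prop :=
  ∃ (c : C) (a : ∀ i, X i ⟶ c), IsConicalCoproduct V a

variable {V}

namespace IsConicalCoproduct

variable {ι : Type*} {X : ι → C} {c : C} {a : ∀ i, X i ⟶ c} (h : IsConicalCoproduct V a)

include h

lemma ehom_ext {U : V} {Z : C} {φ ψ : U ⟶ (c ⟶[V] Z)}
    (H : ∀ i, φ ≫ eHomWhiskerRight V (a i) Z = ψ ≫ eHomWhiskerRight V (a i) Z) : φ = ψ :=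
  (h U Z fun i => ψ ≫ eHomWhiskerRight V (a i) Z).unique H fun _ => rfl

lemma hom_ext {Z : C} {f g : c ⟶ Z} (H : ∀ i, a i ≫ f = a i ≫ g) : f = g :=
  (eHomEquiv V).injective <| h.ehom_ext fun i => by
    rw [eHomEquiv_comp_whiskerRight, eHomEquiv_comp_whiskerRight, H]

lemma exists_desc {Z : C} (f : ∀ i, X i ⟶ Z) : ∃ g : c ⟶ Z, ∀ i, a i ≫ g = f i := by
  obtain ⟨ψ, hψ, -⟩ := h _ Z fun i => eHomEquiv V (f i)
  refine ⟨(eHomEquiv V).symm ψ, fun i => (eHomEquiv V).injective ?_⟩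
  rw [← eHomEquiv_comp_whiskerRight, Equiv.apply_symm_apply, hψ]

/-- The morphism out of a coproduct given by a family of morphisms. -/
def desc {Z : C} (f : ∀ i, X i ⟶ Z) : c ⟶ Z := (h.exists_desc f).choose

@[simp]
lemma fac {Z : C} (f : ∀ i, X i ⟶ Z) (i : ι) : a i ≫ h.desc f = f i :=
  (h.exists_desc f).choose_spec i

end IsConicalCoproduct

lemma HasConicalCoproduct.of_equiv {ι ι' : Type*} {X : ι' → C} (e : ι ≃ ι')
    (h : HasConicalCoproduct V fun i => X (e i)) : HasConicalCoproduct V X := by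
  obtain ⟨c, a, h⟩ := h
  let a' : ∀ i, X i ⟶ c := Equiv.piCongrLeft (fun i => X i ⟶ c) e a
  have ha (i : ι) : a' (e i) = a i := Equiv.piCongrLeft_apply_apply (fun i => X i ⟶ c) e a i
  refine ⟨c, a', fun U Z φ => ?_⟩
  obtain ⟨ψ, hψ, hψ'⟩ := h U Z fun i => φ (e i)
  refine ⟨ψ, fun i => ?_, fun ψ' h' => hψ' _ fun i => by rw [← ha, h']⟩
  obtain ⟨i, rfl⟩ := e.surjective i
  rw [ha, hψ]

section PartialCoproducts

variable {J : Type v} [LinearOrder J] {X : J → C} {c : J → C}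
  {a : ∀ (j : J) (i : Set.Iio j), X i ⟶ c j} (h : ∀ j, IsConicalCoproduct V (a j))

/-- The canonical morphism from the coproduct of the `X i` for `i < j` to the coproduct of the
`X i` for `i < j'`, when `j ≤ j'`. -/
def partialCoproductMap {j j' : J} (hj : j ≤ j') : c j ⟶ c j' :=
  (h j).desc fun i => a j' ⟨i, i.2.trans_le hj⟩

@[simp]
lemma fac_partialCoproductMap {j j' : J} (hj : j ≤ j') (i : J) (hi : i ∈ Set.Iio j) :
    a j ⟨i, hi⟩ ≫ partialCoproductMap h hj = a j' ⟨i, hi.trans_le hj⟩ :=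
  (h j).fac _ _

/-- The functor sending `j` to the coproduct of the objects `X i` for `i < j`. -/
def partialCoproducts : J ⥤ C where
  obj := c
  map f := partialCoproductMap h (leOfHom f)
  map_id j := (h j).hom_ext fun i => by simp
  map_comp {j j' j''} f g := (h j).hom_ext fun ⟨i, hi⟩ => by
    have h₁ := fac_partialCoproductMap h (leOfHom f) i hi
    have h₂ := fac_partialCoproductMap h (leOfHom g) i (hi.trans_le (leOfHom f))
    rw [reassoc_of% h₁, fac_partialCoproductMap]
    exact h₂.symm

/-- Below a limit element `m`, every `i < m` already satisfies `i < k` for some `k < m`, so a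
compatible family on the earlier stages is the same as a family on the summands below `m`. -/
lemma isSmoothChain_partialCoproducts : IsSmoothChain V (partialCoproducts h) := by
  intro m hm
  rw [isConicalColimit_iff]
  intro U Z (φ : ∀ k : Set.Iio m, U ⟶ (c k ⟶[V] Z)) hφ
  replace hφ ⦃k k' : Set.Iio m⦄ (hk : k ≤ k') :
    φ k' ≫ eHomWhiskerRight V (partialCoproductMap h hk) Z = φ k := hφ (homOfLE hk)
  change ∃! ψ : U ⟶ (c m ⟶[V] Z), ∀ k : Set.Iio m,
    ψ ≫ eHomWhiskerRight V (partialCoproductMap h k.2.le) Z = φ k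
  have hm' (i : Set.Iio m) : ∃ k : Set.Iio m, i < k := by
    obtain ⟨k, hk, hk'⟩ := hm.isSuccPrelimit.lt_iff_exists_lt.1 i.2
    exact ⟨⟨k, hk⟩, hk'⟩
  choose s hs' using hm'
  have hs (i : Set.Iio m) : i.1 ∈ Set.Iio (s i).1 := hs' i
  have comp {k k' : Set.Iio m} (hk : k ≤ k') (i : J) (hi : i ∈ Set.Iio k.1)
      (hi' : i ∈ Set.Iio k'.1) :
      φ k ≫ eHomWhiskerRight V (a k ⟨i, hi⟩) Z =
        φ k' ≫ eHomWhiskerRight V (a k' ⟨i, hi'⟩) Z := by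
    rw [← hφ hk, Category.assoc, ← eHomWhiskerRight_comp, fac_partialCoproductMap]
  obtain ⟨ψ, hψ, hψ'⟩ := h m U Z fun i => φ (s i) ≫ eHomWhiskerRight V (a (s i) ⟨i, hs i⟩) Z
  refine ⟨ψ, fun k => (h k).ehom_ext fun i => ?_, fun ψ' h' => hψ' _ fun i => ?_⟩
  · obtain ⟨i, hi⟩ := i
    rw [Category.assoc, ← eHomWhiskerRight_comp, fac_partialCoproductMap, hψ]
    obtain hk | hk := le_total k (s ⟨i, hi.trans k.2⟩)
    · exact (comp hk _ _ _).symm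
    · exact comp hk _ _ _
  · rw [← h' (s i), Category.assoc, ← eHomWhiskerRight_comp, fac_partialCoproductMap]

-- Without a maximal element, every summand occurs at some stage `j`, so the colimit of the partial
-- coproducts is the whole coproduct.
include h in
lemma hasConicalCoproduct_of_partialCoproducts [NoMaxOrder J]
    (hcolim : HasConicalColimit V (partialCoproducts h)) : HasConicalCoproduct V X := by
  obtain ⟨t, ht⟩ := hcolim
  rw [isConicalColimit_iff] at ht
  let τ (j : J) : c j ⟶ t.pt := t.ι.app j
  have hτ {j j' : J} (hj : j ≤ j') : partialCoproductMap h hj ≫ τ j' = τ j := t.w (homOfLE hj)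
  choose s hs' using fun i : J => exists_gt i
  have hs (i : J) : i ∈ Set.Iio (s i) := hs' i
  have fac (i j : J) (hij : i ∈ Set.Iio j) : a j ⟨i, hij⟩ ≫ τ j = a (s i) ⟨i, hs i⟩ ≫ τ (s i) := by
    obtain hj | hj := le_total j (s i)
    · rw [← hτ hj, reassoc_of% fac_partialCoproductMap h hj i hij]
    · rw [← hτ hj, reassoc_of% fac_partialCoproductMap h hj i (hs i)]
  refine ⟨t.pt, fun i => a (s i) ⟨i, hs i⟩ ≫ τ (s i), fun U Z φ => ?_⟩
  choose θ hθ _ using fun j => h j U Z fun i => φ i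
  obtain ⟨ψ, hψ, hψ'⟩ := ht U Z θ fun j j' f => by
    change θ j' ≫ eHomWhiskerRight V (partialCoproductMap h (leOfHom f)) Z = θ j
    refine (h j).ehom_ext fun ⟨i, hi⟩ => ?_
    rw [Category.assoc, ← eHomWhiskerRight_comp, fac_partialCoproductMap, hθ, hθ]
  replace hψ (j : J) : ψ ≫ eHomWhiskerRight V (τ j) Z = θ j := hψ j
  refine ⟨ψ, fun i => ?_, fun ψ' h' => hψ' _ fun j => ?_⟩
  · rw [eHomWhiskerRight_comp, reassoc_of% hψ, hθ]
  · change ψ' ≫ eHomWhiskerRight V (τ j) Z = θ j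
    refine (h j).ehom_ext fun ⟨i, hi⟩ => ?_
    rw [Category.assoc, ← eHomWhiskerRight_comp, fac, hθ, h']

end PartialCoproducts

/-- The object `c` is initial in the `V`-category `C`, in terms of generalized elements. -/
def IsConicalInitial (V : Type u) [Category.{v} V] [MonoidalCategory V]
    [EnrichedOrdinaryCategory V C] (c : C) : Prop :=
  ∀ (U : V) (Z : C), Nonempty (Unique (U ⟶ (c ⟶[V] Z)))

lemma IsConicalInitial.hasConicalCoproduct {c : C} (hc : IsConicalInitial V c) {ι : Type*}
    [IsEmpty ι] (X : ι → C) : HasConicalCoproduct V X :=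
  ⟨c, isEmptyElim, fun U Z _ => by
    obtain ⟨_⟩ := hc U Z
    exact ⟨default, isEmptyElim, fun _ _ => Subsingleton.elim _ _⟩⟩

/-- The universal property of pushouts in a `V`-category, in terms of generalized elements. -/
lemma HasConicalPushouts.exists_pushout (hC : HasConicalPushouts V C) {A B D : C}
    (f : A ⟶ B) (g : A ⟶ D) :
    ∃ (P : C) (l : B ⟶ P) (r : D ⟶ P), f ≫ l = g ≫ r ∧
      ∀ (U : V) (Z : C) (x : U ⟶ (B ⟶[V] Z)) (y : U ⟶ (D ⟶[V] Z)),
        x ≫ eHomWhiskerRight V f Z = y ≫ eHomWhiskerRight V g Z →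
        ∃! ψ : U ⟶ (P ⟶[V] Z), ψ ≫ eHomWhiskerRight V l Z = x ∧
          ψ ≫ eHomWhiskerRight V r Z = y := by
  obtain ⟨t, ht⟩ := hC (span f g)
  rw [isConicalColimit_iff] at ht
  let l : B ⟶ t.pt := t.ι.app .left
  have hl : f ≫ l = t.ι.app .zero := t.w WalkingSpan.Hom.fst
  refine ⟨t.pt, l, t.ι.app .right, hl.trans (t.w WalkingSpan.Hom.snd).symm, fun U Z x y h => ?_⟩
  obtain ⟨ψ, hψ, hψ'⟩ := ht U Z
    (fun
      | .zero => x ≫ eHomWhiskerRight V f Z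
      | .left => x
      | .right => y) (by
      rintro _ _ (_ | _ | _)
      · exact (congrArg _ (eHomWhiskerRight_id _ _ _)).trans (Category.comp_id _)
      · rfl
      · exact h.symm)
  refine ⟨ψ, ⟨hψ .left, hψ .right⟩, fun ψ' ⟨h₁, h₂⟩ => hψ' _ ?_⟩
  rintro (_ | _ | _)
  · have : ψ' ≫ eHomWhiskerRight V (f ≫ l) Z = x ≫ eHomWhiskerRight V f Z := by
      rw [eHomWhiskerRight_comp, reassoc_of% h₁]
    exact (congrArg (ψ' ≫ eHomWhiskerRight V · Z) hl.symm).trans this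
  · exact h₁
  · exact h₂

/-- If a `V`-category has pushouts and an initial object, then adding one object to a family
of objects which has a coproduct gives a family which has a coproduct. -/
lemma HasConicalCoproduct.option {c₀ : C} (hc₀ : IsConicalInitial V c₀)
    (hC : HasConicalPushouts V C) {ι : Type*} {X : Option ι → C}
    (h : HasConicalCoproduct V fun i => X (some i)) : HasConicalCoproduct V X := by
  obtain ⟨c, a, h⟩ := h
  have hom_subsingleton {U : V} {Z : C} (f g : U ⟶ (c₀ ⟶[V] Z)) : f = g := by
    obtain ⟨_⟩ := hc₀ U Z
    exact Subsingleton.elim _ _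
  have hom (Z : C) : Nonempty (c₀ ⟶ Z) := by
    obtain ⟨_⟩ := hc₀ (𝟙_ V) Z
    exact ⟨(eHomEquiv V).symm default⟩
  -- A binary coproduct is a pushout over the initial object, where compatibility is automatic.
  obtain ⟨⟨f⟩, ⟨g⟩⟩ := And.intro (hom c) (hom (X none))
  obtain ⟨P, l, r, -, hP⟩ := hC.exists_pushout f g
  refine ⟨P, fun | none => r | some i => a i ≫ l, fun U Z φ => ?_⟩
  obtain ⟨θ, hθ, hθ'⟩ := h U Z fun i => φ (some i)
  obtain ⟨ψ, ⟨hψ₁, hψ₂⟩, hψ'⟩ := hP U Z θ (φ none) (hom_subsingleton _ _)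
  refine ⟨ψ, ?_, fun ψ' h' => hψ' _ ⟨hθ' _ fun i => ?_, h' none⟩⟩
  · rintro (_ | i)
    · exact hψ₂
    · dsimp only
      rw [eHomWhiskerRight_comp, reassoc_of% hψ₁, hθ]
  · have := h' (some i)
    dsimp only at this
    rw [← this, eHomWhiskerRight_comp, Category.assoc]

/-- A `V`-category with an initial object, pushouts and transfinite composites has
small coproducts. -/
lemma hasConicalCoproduct {c₀ : C} (hc₀ : IsConicalInitial V c₀) (hC : HasConicalPushouts V C)
    (hC' : HasTransfiniteComposites V C) {ι : Type v} (X : ι → C) : HasConicalCoproduct V X := by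
  have of_noMax (J : Type v) [LinearOrder J] [WellFoundedLT J] [Nonempty J] [NoMaxOrder J]
      (Y : J → C) (hY : ∀ j, HasConicalCoproduct V fun i : Set.Iio j => Y i.1) :
      HasConicalCoproduct V Y := by
    choose c a h using hY
    let := WellFoundedLT.toOrderBot J
    let := SuccOrder.ofLinearWellFoundedLT J
    exact hasConicalCoproduct_of_partialCoproducts h
      (hC' J _ (isSmoothChain_partialCoproducts h))
  -- Transfinite induction on `j`: a successor adds one summand, and for a limit `j` the segment
  -- below `j` has no maximum.
  have partials (J : Type v) [LinearOrder J] [WellFoundedLT J] (Y : J → C) (j : J) :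
      HasConicalCoproduct V fun i : Set.Iio j => Y i.1 := by
    let := SuccOrder.ofLinearWellFoundedLT J
    induction j using SuccOrder.limitRecOn with
    | isMin j hj =>
      have : IsEmpty (Set.Iio j) := ⟨fun i => hj.not_lt i.2⟩
      exact hc₀.hasConicalCoproduct _
    | succ j hj ih =>
      let f : Option (Set.Iio j) → Set.Iio (Order.succ j) :=
        fun i => i.elim ⟨j, Order.lt_succ_of_not_isMax hj⟩
          fun i => ⟨i, i.2.trans_le (Order.le_succ j)⟩
      have hf : Function.Bijective f := by
        constructor
        · rintro (_ | ⟨i, hi⟩) (_ | ⟨i', hi'⟩) H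
          · rfl
          · exact (hi'.ne (congrArg Subtype.val H).symm).elim
          · exact (hi.ne (congrArg Subtype.val H)).elim
          · obtain rfl : i = i' := congrArg Subtype.val H
            rfl
        · rintro ⟨i, hi⟩
          obtain hi | rfl := ((Order.lt_succ_iff_of_not_isMax hj).1 hi).lt_or_eq
          · exact ⟨some ⟨i, hi⟩, rfl⟩
          · exact ⟨none, rfl⟩
      exact .of_equiv (Equiv.ofBijective f hf) (.option hc₀ hC ih)
    | isSuccLimit j hj ih =>
      have : Nonempty (Set.Iio j) := by
        obtain ⟨i, hi⟩ := not_isMin_iff.1 hj.not_isMin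
        exact ⟨i, hi⟩
      have : NoMaxOrder (Set.Iio j) := ⟨fun i => by
        obtain ⟨k, hk, hk'⟩ := hj.isSuccPrelimit.lt_iff_exists_lt.1 i.2
        exact ⟨⟨k, hk⟩, hk'⟩⟩
      refine of_noMax _ _ fun k => ?_
      let e : Set.Iio k.1 ≃ Set.Iio k :=
        { toFun := fun i => ⟨⟨i, i.2.trans k.2⟩, i.2⟩
          invFun := fun i => ⟨i.1, i.2⟩ }
      exact .of_equiv e (ih k k.2)
  obtain ⟨_, _⟩ := exists_wellFoundedLT ι
  -- Adjoining a top element makes all of `ι` a proper initial segment. The object `c₀` placed at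
  -- `⊤` below is a dummy value.
  let e : Set.Iio (⊤ : WithTop ι) ≃ ι :=
    { toFun := fun i => i.1.untop i.2.ne
      invFun := fun i => ⟨i, WithTop.coe_lt_top i⟩
      left_inv := fun i => by simp
      right_inv := fun i => by simp }
  refine .of_equiv e ?_
  convert partials (WithTop ι) (fun i => i.recTopCoe c₀ X) ⊤ with i
  obtain ⟨i, rfl⟩ := e.symm.surjective i
  rfl

lemma hasConicalColimit_discrete {ι : Type*} (F : Discrete ι ⥤ C)
    (hF : HasConicalCoproduct V fun i => F.obj ⟨i⟩) : HasConicalColimit V F := by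
  obtain ⟨c, a, h⟩ := hF
  refine ⟨⟨c, Discrete.natTrans fun i => a i.as⟩, ?_⟩
  rw [isConicalColimit_iff]
  intro U Z φ hφ
  obtain ⟨ψ, hψ, hψ'⟩ := h U Z fun i => φ ⟨i⟩
  exact ⟨ψ, fun i => hψ i.as, fun ψ' h' => hψ' _ fun i => h' ⟨i⟩⟩

end Coproducts

/-! ### Cocompleteness, and conicality of all small colimits -/

section PreservesColimits

variable {V : Type u} [Category.{v} V] [MonoidalCategory V]
  {C : Type u'} [Category.{v} C] [EnrichedOrdinaryCategory V C]

lemma preservesColimitsOfShape_eYoneda_rightOp {J : Type*} [Category* J]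
    (h : ∀ F : J ⥤ C, HasConicalColimit V F) (Z : C) :
    PreservesColimitsOfShape J (eYoneda V Z).rightOp where
  preservesColimit {F} := by
    obtain ⟨c, hc⟩ := h F
    have : PreservesLimit F.op (eYoneda V Z) :=
      preservesLimit_of_preserves_limit_cone hc.isColimit.some.op (hc.isLimit_eYoneda Z).some
    exact preservesColimit_rightOp F (eYoneda V Z)

lemma IsConicalInitial.hasConicalColimit {c : C} (hc : IsConicalInitial V c)
    (F : Discrete PEmpty.{1} ⥤ C) : HasConicalColimit V F :=
  hasConicalColimit_discrete F (hc.hasConicalCoproduct _)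

variable {c : C} (hc : IsConicalInitial V c) (hC : HasConicalPushouts V C)
  (hC' : HasTransfiniteComposites V C)

include hC in
lemma HasConicalPushouts.hasPushouts : HasPushouts C where
  has_colimit F := (hC F).hasColimit

include hc in
lemma IsConicalInitial.hasInitial : HasInitial C where
  has_colimit F := (hc.hasConicalColimit F).hasColimit

include hc hC hC' in
lemma hasCoproducts_of_conical : HasCoproducts.{v} C := fun _ =>
  { has_colimit := fun F =>
      (hasConicalColimit_discrete F (hasConicalCoproduct hc hC hC' _)).hasColimit }

include hc hC hC' in
lemma hasColimits_of_conical : HasColimitsOfSize.{v, v} C := by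
  have := hC.hasPushouts
  have := hc.hasInitial
  have := hasCoproducts_of_conical hc hC hC'
  have : HasFiniteColimits C := hasFiniteColimits_of_hasInitial_and_pushouts
  exact has_colimits_of_hasCoequalizers_and_coproducts

-- All small colimits are built from the initial object, pushouts and coproducts. Passing to
-- `rightOp` makes the representables covariant, so preservation of these three kinds of colimit
-- suffices.
include hc hC hC' in
lemma preservesLimits_eYoneda (Z : C) : PreservesLimitsOfSize.{v, v} (eYoneda V Z) := by
  have := hC.hasPushouts
  have := hc.hasInitial
  have := hasCoproducts_of_conical hc hC hC'
  have : HasFiniteColimits C := hasFiniteColimits_of_hasInitial_and_pushouts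
  have := preservesColimitsOfShape_eYoneda_rightOp hC Z
  have := preservesColimitsOfShape_eYoneda_rightOp hc.hasConicalColimit Z
  have := preservesFiniteColimits_of_preservesInitial_and_pushouts (eYoneda V Z).rightOp
  have (ι : Type v) := preservesColimitsOfShape_eYoneda_rightOp (V := V) (C := C)
    (fun F : Discrete ι ⥤ C => hasConicalColimit_discrete F (hasConicalCoproduct hc hC hC' _)) Z
  have := preservesColimits_of_preservesCoequalizers_and_coproducts (eYoneda V Z).rightOp
  exact preservesLimitsOfSize_of_rightOp _

/-- Colimits in `C₀` are colimits in the `V`-category `C` as soon as the representable functors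
send colimits to limits. -/
lemma isConicalColimit_of_isColimit {J : Type v} [Category.{v} J] {F : J ⥤ C} {t : Cocone F}
    (ht : IsColimit t) (h : ∀ Z : C, PreservesLimitsOfSize.{v, v} (eYoneda V Z)) :
    IsConicalColimit V t where
  isColimit := ⟨ht⟩
  isLimit_eYoneda Z :=
    ⟨isLimitOfPreserves (eYoneda V Z) ht.op⟩

end PreservesColimits

/-! ### Saturation of the enriched left class -/

section LeftLifting

section

variable {C : Type*} [Category* C] {D : Type*} [Category* D]

/-- If `G` preserves colimits and sends the morphisms in `M` to morphisms with the left lifting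
property with respect to `S`, then it also does so for the morphisms in `M.rlp.llp`. -/
lemma llp_rlp_le_inverseImage_llp (M : MorphismProperty C)
    [MorphismProperty.HasSmallObjectArgument.{v} M] (S : MorphismProperty D) (G : C ⥤ D)
    [PreservesColimitsOfSize.{v, v} G] [PreservesFiniteColimits G]
    (hM : M ≤ S.llp.inverseImage G) : M.rlp.llp ≤ S.llp.inverseImage G := by
  have h_coproducts : MorphismProperty.coproducts.{v} M ≤ S.llp.inverseImage G := by
    intro X Y f hf
    rw [MorphismProperty.coproducts_iff] at hf
    obtain ⟨J, ⟨X₁, X₂, c₁, c₂, h₁, h₂, f, hf⟩⟩ := hf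
    refine MorphismProperty.colimitsOfShape_le (W := S.llp) (J := Discrete J) _
      (.mk' _ _ _ _ (isColimitOfPreserves G h₁) (isColimitOfPreserves G h₂)
        (Functor.whiskerRight f G) (fun j => hM _ (hf j)) _ fun j => ?_)
    exact (G.map_comp _ _).symm.trans ((congrArg G.map (h₁.fac _ j)).trans (G.map_comp _ _))
  have h_pushouts : (MorphismProperty.coproducts.{v} M).pushouts ≤ S.llp.inverseImage G := by
    rintro X Y f ⟨A, B, g, _, _, hg, h⟩
    exact S.llp.of_isPushout (h.map G) (h_coproducts _ hg)
  -- Members of `M.rlp.llp` are retracts of transfinite compositions of pushouts of coproducts of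
  -- members of `M`; `G` respects each operation and `S.llp` is closed under it.
  rw [MorphismProperty.llp_rlp_of_hasSmallObjectArgument.{v}]
  rintro X Y f ⟨X', Y', g, r, hg⟩
  refine MorphismProperty.of_retract (P := S.llp) (r.map G) ?_
  rw [MorphismProperty.transfiniteCompositions_iff] at hg
  obtain ⟨J, _, _, _, _, hg⟩ := hg
  refine MorphismProperty.transfiniteCompositionsOfShape_le (W := S.llp) J _ ?_
  have : PreservesWellOrderContinuousOfShape J G := ⟨fun _ _ => inferInstance⟩
  exact MorphismProperty.transfiniteCompositionsOfShape_map_of_preserves J G g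
    (MorphismProperty.transfiniteCompositionsOfShape_monotone J h_pushouts _ hg)

end

section

variable {V : Type u} [Category.{v} V] [MonoidalCategory V]
  {C : Type u'} [Category.{v} C] [EnrichedOrdinaryCategory V C]

variable (V) in
/-- The functor from `C₀ᵒᵖ` to the arrows of `V₀` which sends `A` to `C(A, k) : C(A, X) ⟶ C(A, Y)`. -/
abbrev eHomArrow {X Y : C} (k : X ⟶ Y) : Cᵒᵖ ⥤ ComposableArrows V 1 :=
  eHomFunctor V C ⋙ (Functor.whiskeringLeft _ _ V).obj (ComposableArrows.mk₁ k)

variable [HasPullbacks V] {A B X Y : C} (f : A ⟶ B) (k : X ⟶ Y)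

lemma toSq_fst : toSq V f k ≫ pullback.fst _ _ = eHomWhiskerRight V f X :=
  pullback.lift_fst _ _ _

lemma toSq_snd : toSq V f k ≫ pullback.snd _ _ = eHomWhiskerLeft V B k :=
  pullback.lift_snd _ _ _

/-- Lifting against `e_{f,k}` in elementary terms. -/
lemma hasLiftingProperty_toSq_iff {P Q : V} (j : P ⟶ Q) :
    HasLiftingProperty j (toSq V f k) ↔
      ∀ (p : P ⟶ (B ⟶[V] X)) (q : Q ⟶ (A ⟶[V] X)) (r : Q ⟶ (B ⟶[V] Y)),
        p ≫ eHomWhiskerRight V f X = j ≫ q → p ≫ eHomWhiskerLeft V B k = j ≫ r →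
        q ≫ eHomWhiskerLeft V A k = r ≫ eHomWhiskerRight V f Y →
        ∃ l : Q ⟶ (B ⟶[V] X), j ≫ l = p ∧ l ≫ eHomWhiskerRight V f X = q ∧
          l ≫ eHomWhiskerLeft V B k = r := by
  constructor
  · intro h p q r h₁ h₂ h₃
    have sq : CommSq p j (toSq V f k) (pullback.lift q r h₃) := ⟨by
      apply pullback.hom_ext
      · rw [Category.assoc, Category.assoc, toSq_fst, pullback.lift_fst, h₁]
      · rw [Category.assoc, Category.assoc, toSq_snd, pullback.lift_snd, h₂]⟩
    refine ⟨sq.lift, sq.fac_left, ?_, ?_⟩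
    · have := sq.fac_right =≫ pullback.fst _ _
      rwa [Category.assoc, toSq_fst, pullback.lift_fst] at this
    · have := sq.fac_right =≫ pullback.snd _ _
      rwa [Category.assoc, toSq_snd, pullback.lift_snd] at this
  · refine fun h => ⟨fun {p s} sq => ?_⟩
    obtain ⟨l, h₁, h₂, h₃⟩ := h p (s ≫ pullback.fst _ _) (s ≫ pullback.snd _ _)
      (by rw [← toSq_fst, sq.w_assoc]) (by rw [← toSq_snd, sq.w_assoc])
      (by rw [Category.assoc, Category.assoc, pullback.condition])
    refine ⟨⟨⟨l, h₁, ?_⟩⟩⟩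
    apply pullback.hom_ext
    · rw [Category.assoc, toSq_fst, h₂]
    · rw [Category.assoc, toSq_snd, h₃]

/-- Lifting squares for `e_{f,k}` against `j` are lifting squares in the category of arrows. -/
lemma hasLiftingProperty_toSq_iff_eHomArrow {P Q : V} (j : P ⟶ Q) :
    HasLiftingProperty j (toSq V f k) ↔
      HasLiftingProperty
        (ComposableArrows.homMk₁ j (𝟙 Q) : ComposableArrows.mk₁ j ⟶ ComposableArrows.mk₁ (𝟙 Q))
        ((eHomArrow V k).map f.op) := by
  rw [hasLiftingProperty_toSq_iff]
  constructor
  · intro h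
    refine ⟨fun {s t} sq => ?_⟩
    let p : P ⟶ (B ⟶[V] X) := s.app 0
    let r : Q ⟶ (B ⟶[V] Y) := s.app 1
    let q : Q ⟶ (A ⟶[V] X) := t.app 0
    -- The identity in the target arrow makes `q'` redundant: it is determined by `q` and also by
    -- `r`. Likewise a lift has second component `r`.
    let q' : Q ⟶ (A ⟶[V] Y) := t.app 1
    have hs : j ≫ r = p ≫ eHomWhiskerLeft V B k :=
      s.naturality (homOfLE (by decide) : (0 : Fin 2) ⟶ 1)
    have ht : 𝟙 _ ≫ q' = q ≫ eHomWhiskerLeft V A k :=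
      t.naturality (homOfLE (by decide) : (0 : Fin 2) ⟶ 1)
    have h₀ : p ≫ eHomWhiskerRight V f X = j ≫ q := congr_app sq.w 0
    have h₁ : r ≫ eHomWhiskerRight V f Y = 𝟙 _ ≫ q' := congr_app sq.w 1
    obtain ⟨l, hl, hl', hl''⟩ := h p q r h₀ hs.symm (ht.symm.trans h₁.symm)
    refine ⟨⟨⟨ComposableArrows.homMk₁ l r ((Category.id_comp _).trans hl''.symm), ?_, ?_⟩⟩⟩
    · exact ComposableArrows.hom_ext₁ hl (Category.id_comp _)
    · exact ComposableArrows.hom_ext₁ hl' (h₁.trans (Category.id_comp _))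
  · intro h p q r h₁ h₂ h₃
    let s : ComposableArrows.mk₁ j ⟶ (eHomArrow V k).obj (.op B) :=
      ComposableArrows.homMk₁ p r h₂.symm
    let t : ComposableArrows.mk₁ (𝟙 Q) ⟶ (eHomArrow V k).obj (.op A) :=
      ComposableArrows.homMk₁ q (r ≫ eHomWhiskerRight V f Y)
        ((Category.id_comp _).trans h₃.symm)
    let τ : ComposableArrows.mk₁ j ⟶ ComposableArrows.mk₁ (𝟙 Q) :=
      ComposableArrows.homMk₁ j (𝟙 Q)
    have sq : CommSq s τ ((eHomArrow V k).map f.op) t :=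
      ⟨ComposableArrows.hom_ext₁ h₁ (Category.id_comp _).symm⟩
    refine ⟨sq.lift.app 0, congr_app sq.fac_left 0, congr_app sq.fac_right 0, ?_⟩
    have h₄ : 𝟙 _ ≫ sq.lift.app 1 = r := congr_app sq.fac_left 1
    have h₅ : 𝟙 _ ≫ sq.lift.app 1 = sq.lift.app 0 ≫ eHomWhiskerLeft V B k :=
      sq.lift.naturality (homOfLE (by decide) : (0 : Fin 2) ⟶ 1)
    exact h₅.symm.trans h₄

/-- The left class of the `F`-lifting property, for `F` cofibrantly generated, contains `M.rlp.llp`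
whenever it contains `M`. -/
lemma llp_rlp_le_enrichedLlp (hC : ∀ Z : C, PreservesLimitsOfSize.{v, v} (eYoneda V Z))
    (J : MorphismProperty V) (M N : MorphismProperty C)
    [MorphismProperty.HasSmallObjectArgument.{v} M] (hM : M ≤ enrichedLlp J.rlp N) :
    M.rlp.llp ≤ enrichedLlp J.rlp N := by
  intro A B f hf X Y k hk P Q j hj
  let τ : ComposableArrows.mk₁ j ⟶ ComposableArrows.mk₁ (𝟙 Q) := ComposableArrows.homMk₁ j (𝟙 Q)
  -- Dualizing puts the image of `f` on the left of the lifting problem, and `G` is cocontinuous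
  -- because limits of arrows are computed pointwise from `C(-, X)` and `C(-, Y)`.
  let G : C ⥤ (ComposableArrows V 1)ᵒᵖ := (eHomArrow V k).rightOp
  have key {A B : C} (f : A ⟶ B) : HasLiftingProperty j (toSq V f k) ↔
      HasLiftingProperty (G.map f) τ.op := by
    rw [hasLiftingProperty_toSq_iff_eHomArrow]
    exact HasLiftingProperty.iff_op
  have : PreservesLimitsOfSize.{v, v} (eHomArrow V k) :=
    preservesLimits_of_evaluation _ fun i => hC _
  have : PreservesColimitsOfSize.{v, v} G := preservesColimitsOfSize_rightOp _
  have : PreservesFiniteColimits G := PreservesColimitsOfSize.preservesFiniteColimits G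
  have := llp_rlp_le_inverseImage_llp M (MorphismProperty.ofHoms fun _ : Unit => τ.op) G
    (by
      intro A B f hf
      rw [MorphismProperty.inverseImage_iff,
        MorphismProperty.llp_ofHoms_iff_hasLiftingProperty, ← key]
      exact hM f hf k hk j hj) f hf
  rw [MorphismProperty.inverseImage_iff,
    MorphismProperty.llp_ofHoms_iff_hasLiftingProperty, ← key] at this
  exact this

end

end LeftLifting

/-! ### Transposition along copower units -/

section Transpose

variable {V : Type u} [Category.{v} V] [MonoidalCategory V]
  {C : Type u'} [Category.{v} C] [EnrichedOrdinaryCategory V C]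

variable (V) in
/-- Whiskering in the middle of the enriched composition. -/
lemma eHomWhiskerLeft_whiskerRight_eComp (A : C) {T T' : C} (t : T ⟶ T') (X : C) :
    eHomWhiskerLeft V A t ▷ _ ≫ eComp V A T' X =
      _ ◁ eHomWhiskerRight V t X ≫ eComp V A T X := by
  simp only [eHomWhiskerLeft, eHomWhiskerRight, comp_whiskerRight, Category.assoc,
    MonoidalCategory.whiskerLeft_comp, MonoidalCategory.whisker_assoc]
  simp

/-- The morphism `U ⊗ W ⟶ C(A, X)` induced by `φ : W ⟶ C(T, X)` and `η : U ⟶ C(A, T)`. -/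
def transpose {U W : V} {A T X : C} (η : U ⟶ (A ⟶[V] T)) (φ : W ⟶ (T ⟶[V] X)) :
    U ⊗ W ⟶ (A ⟶[V] X) :=
  U ◁ φ ≫ η ▷ _ ≫ eComp V A T X

variable {U W : V} {A T X : C} (η : U ⟶ (A ⟶[V] T)) (φ : W ⟶ (T ⟶[V] X))

lemma transpose_comp {W' : V} (w : W' ⟶ W) : transpose η (w ≫ φ) = U ◁ w ≫ transpose η φ := by
  simp [transpose]

lemma transpose_comp_left {U' : V} (u : U' ⟶ U) : transpose (u ≫ η) φ = u ▷ W ≫ transpose η φ := by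
  simp [transpose, whisker_exchange_assoc]

lemma transpose_whiskerLeft {X' : C} (k : X ⟶ X') :
    transpose η (φ ≫ eHomWhiskerLeft V T k) = transpose η φ ≫ eHomWhiskerLeft V A k := by
  simp [transpose, eComp_eHomWhiskerLeft, whisker_exchange_assoc]

lemma transpose_whiskerRight {A' : C} (i : A' ⟶ A) :
    transpose (η ≫ eHomWhiskerRight V i T) φ = transpose η φ ≫ eHomWhiskerRight V i X := by
  simp [transpose, eComp_eHomWhiskerRight]

/-- Extranaturality of composition in the middle object: `t` may be absorbed on either side. -/
lemma transpose_whiskerRight_eq {T' : C} (t : T' ⟶ T) (η : U ⟶ (A ⟶[V] T')) :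
    transpose η (φ ≫ eHomWhiskerRight V t X) = transpose (η ≫ eHomWhiskerLeft V A t) φ := by
  simp only [transpose, comp_whiskerRight, Category.assoc, MonoidalCategory.whiskerLeft_comp,
    eHomWhiskerLeft_whiskerRight_eComp, whisker_exchange_assoc]

lemma transpose_eHomEquiv (t : T ⟶ X) :
    (ρ_ U).inv ≫ transpose η (eHomEquiv V t) = η ≫ eHomWhiskerLeft V A t := by
  simp [transpose, eHomWhiskerLeft, whisker_exchange_assoc]

section

variable [MonoidalClosed V]

lemma curry_transpose :
    MonoidalClosed.curry (transpose η φ) = φ ≫ copowerComparison η X := by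
  rw [copowerComparison, ← MonoidalClosed.curry_natural_left]
  rfl

variable {η} (hη : IsCopower η)

include hη

lemma IsCopower.bijective_transpose (W : V) (X : C) :
    Function.Bijective fun φ : W ⟶ (T ⟶[V] X) => transpose η φ := by
  have := hη X
  constructor
  · intro φ ψ h
    rw [← cancel_mono (copowerComparison η X), ← curry_transpose, ← curry_transpose]
    exact congrArg _ h
  · intro f
    refine ⟨MonoidalClosed.curry f ≫ inv (copowerComparison η X),
      MonoidalClosed.curry_injective ?_⟩
    dsimp only
    rw [curry_transpose, Category.assoc, IsIso.inv_hom_id, Category.comp_id]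

/-- The case `W = 𝟙_ V` of `IsCopower.bijective_transpose`, read through the right unitor. -/
lemma IsCopower.bijective (X : C) :
    Function.Bijective fun t : T ⟶ X => η ≫ eHomWhiskerLeft V A t := by
  have : (fun t : T ⟶ X => η ≫ eHomWhiskerLeft V A t) =
      (fun f => (ρ_ U).inv ≫ f) ∘ (fun φ => transpose η φ) ∘ eHomEquiv V := by
    funext t
    exact (transpose_eHomEquiv η t).symm
  rw [this]
  exact ((ρ_ U).homFromEquiv (Z := (A ⟶[V] X))).bijective.comp
    ((hη.bijective_transpose _ _).comp (eHomEquiv V).bijective)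

end

end Transpose

/-! ### Pushout-products with respect to copowers -/

section Corners

variable {V : Type u} [Category.{v} V] [MonoidalCategory V] [MonoidalClosed V]
  {C : Type u'} [Category.{v} C] [EnrichedOrdinaryCategory V C]

/-- The morphism `c : P ⟶ T` is the pushout-product of `j : U ⟶ U'` and `i : A ⟶ B` with
respect to copowers: `T` is the copower `U' ⊙ B`, and `P` is the pushout of `U' ⊙ A` and
`U ⊙ B` over `U ⊙ A`. -/
structure CopowerCorner {U U' : V} (j : U ⟶ U') {A B : C} (i : A ⟶ B) {P T : C}
    (c : P ⟶ T) where
  /-- the unit of the copower `U' ⊙ B` -/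
  η : U' ⟶ (B ⟶[V] T)
  isCopower : IsCopower η
  /-- the morphism corresponding to `U' ⊙ A ⟶ P` -/
  α : U' ⟶ (A ⟶[V] P)
  /-- the morphism corresponding to `U ⊙ B ⟶ P` -/
  β : U ⟶ (B ⟶[V] P)
  α_comp : α ≫ eHomWhiskerLeft V A c = η ≫ eHomWhiskerRight V i T
  β_comp : β ≫ eHomWhiskerLeft V B c = j ≫ η
  comp_α : j ≫ α = β ≫ eHomWhiskerRight V i P
  existsUnique_transpose (W : V) (X : C) (x : U' ⊗ W ⟶ (A ⟶[V] X)) (y : U ⊗ W ⟶ (B ⟶[V] X)) :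
    j ▷ W ≫ x = y ≫ eHomWhiskerRight V i X →
    ∃! φ : W ⟶ (P ⟶[V] X), transpose α φ = x ∧ transpose β φ = y

lemma exists_copowerCorner (hC : HasConicalPushouts V C) (hC' : IsCopowered V C)
    {U U' : V} (j : U ⟶ U') {A B : C} (i : A ⟶ B) :
    ∃ (P T : C) (c : P ⟶ T), Nonempty (CopowerCorner j i c) := by
  obtain ⟨T₁, η₁, h₁⟩ := hC' U A
  obtain ⟨T₂, η₂, h₂⟩ := hC' U B
  obtain ⟨T₃, η₃, h₃⟩ := hC' U' A
  obtain ⟨T, η, h⟩ := hC' U' B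
  -- The four sides of the square are `a = U ⊙ i`, `b = j ⊙ A`, `m = U' ⊙ i` and `n = j ⊙ B`; the
  -- corner is induced from the pushout of `b` and `a`.
  obtain ⟨a, ha⟩ := (h₁.bijective T₂).2 (η₂ ≫ eHomWhiskerRight V i T₂)
  obtain ⟨b, hb⟩ := (h₁.bijective T₃).2 (j ≫ η₃)
  obtain ⟨m, hm⟩ := (h₃.bijective T).2 (η ≫ eHomWhiskerRight V i T)
  obtain ⟨n, hn⟩ := (h₂.bijective T).2 (j ≫ η)
  dsimp only at ha hb hm hn
  obtain ⟨P, l, r, w, hP⟩ := hC.exists_pushout b a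
  have hmn : b ≫ m = a ≫ n := (h₁.bijective T).1 (by
    dsimp only
    rw [eHomWhiskerLeft_comp, eHomWhiskerLeft_comp, reassoc_of% hb, reassoc_of% ha, hm,
      ← eHom_whisker_exchange, reassoc_of% hn])
  obtain ⟨ψ, ⟨hψ₁, hψ₂⟩, -⟩ := hP (𝟙_ V) T (eHomEquiv V m) (eHomEquiv V n) (by
    rw [eHomEquiv_comp_whiskerRight, eHomEquiv_comp_whiskerRight, hmn])
  obtain ⟨c, rfl⟩ := (eHomEquiv V).surjective ψ
  rw [eHomEquiv_comp_whiskerRight, EmbeddingLike.apply_eq_iff_eq] at hψ₁ hψ₂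
  refine ⟨P, T, c, ⟨⟨η, h, η₃ ≫ eHomWhiskerLeft V A l, η₂ ≫ eHomWhiskerLeft V B r, ?_, ?_, ?_,
    fun W X x y hxy => ?_⟩⟩⟩
  · rw [Category.assoc, ← eHomWhiskerLeft_comp, hψ₁, hm]
  · rw [Category.assoc, ← eHomWhiskerLeft_comp, hψ₂, hn]
  · rw [← reassoc_of% hb, ← eHomWhiskerLeft_comp, w, eHomWhiskerLeft_comp, reassoc_of% ha,
      Category.assoc, eHom_whisker_exchange]
  · obtain ⟨x, rfl⟩ := (h₃.bijective_transpose W X).2 x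
    obtain ⟨y, rfl⟩ := (h₂.bijective_transpose W X).2 y
    dsimp only at hxy ⊢
    obtain ⟨φ, ⟨hφ₁, hφ₂⟩, hφ⟩ := hP W X x y ((h₁.bijective_transpose W X).1 (by
      dsimp only
      rw [transpose_whiskerRight_eq, transpose_whiskerRight_eq, ha, hb, transpose_comp_left,
        hxy, transpose_whiskerRight]))
    refine ⟨φ, ⟨?_, ?_⟩, fun φ' ⟨h₁, h₂'⟩ => hφ _ ⟨?_, ?_⟩⟩
    · rw [← transpose_whiskerRight_eq, hφ₁]
    · rw [← transpose_whiskerRight_eq, hφ₂]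
    · rw [← transpose_whiskerRight_eq] at h₁
      exact (h₃.bijective_transpose W X).1 h₁
    · rw [← transpose_whiskerRight_eq] at h₂'
      exact (h₂.bijective_transpose W X).1 h₂'

namespace CopowerCorner

variable {U U' : V} {j : U ⟶ U'} {A B : C} {i : A ⟶ B} {P T : C} {c : P ⟶ T}
  (h : CopowerCorner j i c)

include h

lemma ehom_ext {W : V} {X : C} {φ ψ : W ⟶ (P ⟶[V] X)}
    (h₁ : transpose h.α φ = transpose h.α ψ) (h₂ : transpose h.β φ = transpose h.β ψ) : φ = ψ :=
  (h.existsUnique_transpose W X (transpose h.α ψ) (transpose h.β ψ) (by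
    rw [← transpose_comp_left, h.comp_α, transpose_whiskerRight])).unique ⟨h₁, h₂⟩ ⟨rfl, rfl⟩

lemma hom_ext {X : C} {f g : P ⟶ X}
    (h₁ : h.α ≫ eHomWhiskerLeft V A f = h.α ≫ eHomWhiskerLeft V A g)
    (h₂ : h.β ≫ eHomWhiskerLeft V B f = h.β ≫ eHomWhiskerLeft V B g) : f = g := by
  rw [← transpose_eHomEquiv, ← transpose_eHomEquiv, cancel_epi] at h₁ h₂
  exact (eHomEquiv V).injective (h.ehom_ext h₁ h₂)

lemma exists_desc {X : C} (x : U' ⟶ (A ⟶[V] X)) (y : U ⟶ (B ⟶[V] X))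
    (hxy : j ≫ x = y ≫ eHomWhiskerRight V i X) :
    ∃ f : P ⟶ X, h.α ≫ eHomWhiskerLeft V A f = x ∧ h.β ≫ eHomWhiskerLeft V B f = y := by
  obtain ⟨φ, ⟨hφ₁, hφ₂⟩, -⟩ := h.existsUnique_transpose (𝟙_ V) X ((ρ_ U').hom ≫ x)
    ((ρ_ U).hom ≫ y) (by simp [← hxy])
  obtain ⟨f, rfl⟩ := (eHomEquiv V).surjective φ
  refine ⟨f, ?_, ?_⟩
  · rw [← transpose_eHomEquiv, hφ₁, Iso.inv_hom_id_assoc]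
  · rw [← transpose_eHomEquiv, hφ₂, Iso.inv_hom_id_assoc]

/-- Lifting against a pushout-product with respect to copowers is enriched lifting. -/
lemma hasLiftingProperty_iff [HasPullbacks V] {X Y : C} (k : X ⟶ Y) :
    HasLiftingProperty c k ↔ HasLiftingProperty j (toSq V i k) := by
  rw [hasLiftingProperty_toSq_iff]
  constructor
  · intro hc p q r h₁ h₂ h₃
    -- The data `(q, p)` on the two legs of the pushout amount to `u : P ⟶ X`, and `r` amounts to `w
    -- : T ⟶ Y`.
    obtain ⟨u, hu₁, hu₂⟩ := h.exists_desc q p h₁.symm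
    obtain ⟨w, hw⟩ := (h.isCopower.bijective Y).2 r
    dsimp only at hw
    have sq : CommSq u c k w := ⟨h.hom_ext
      (by rw [eHomWhiskerLeft_comp, eHomWhiskerLeft_comp, reassoc_of% hu₁,
            reassoc_of% h.α_comp, h₃, ← hw, Category.assoc, eHom_whisker_exchange])
      (by rw [eHomWhiskerLeft_comp, eHomWhiskerLeft_comp, reassoc_of% hu₂,
            reassoc_of% h.β_comp, h₂, hw])⟩
    refine ⟨h.η ≫ eHomWhiskerLeft V B sq.lift, ?_, ?_, ?_⟩
    · rw [← reassoc_of% h.β_comp, ← eHomWhiskerLeft_comp, sq.fac_left, hu₂]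
    · rw [Category.assoc, eHom_whisker_exchange, ← reassoc_of% h.α_comp,
        ← eHomWhiskerLeft_comp, sq.fac_left, hu₁]
    · rw [Category.assoc, ← eHomWhiskerLeft_comp, sq.fac_right, hw]
  · refine fun H => ⟨fun {u w} sq => ?_⟩
    obtain ⟨L, hL₁, hL₂, hL₃⟩ := H (h.β ≫ eHomWhiskerLeft V B u) (h.α ≫ eHomWhiskerLeft V A u)
      (h.η ≫ eHomWhiskerLeft V B w)
      (by rw [Category.assoc, eHom_whisker_exchange, reassoc_of% h.comp_α])
      (by rw [Category.assoc, ← eHomWhiskerLeft_comp, sq.w, eHomWhiskerLeft_comp,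
            reassoc_of% h.β_comp])
      (by rw [Category.assoc, ← eHomWhiskerLeft_comp, sq.w, eHomWhiskerLeft_comp,
            reassoc_of% h.α_comp, Category.assoc, eHom_whisker_exchange])
    obtain ⟨l, rfl⟩ := (h.isCopower.bijective X).2 L
    dsimp only at hL₁ hL₂ hL₃
    refine ⟨⟨⟨l, h.hom_ext ?_ ?_, (h.isCopower.bijective Y).1 ?_⟩⟩⟩
    · rw [eHomWhiskerLeft_comp, reassoc_of% h.α_comp, ← hL₂, Category.assoc,
        eHom_whisker_exchange]
    · rw [eHomWhiskerLeft_comp, reassoc_of% h.β_comp, hL₁]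
    · dsimp only
      rw [eHomWhiskerLeft_comp, ← hL₃, Category.assoc]

/-- Lifting against `e_{c,k}`, for `c` the pushout-product of `j` and `i`, follows from lifting
of the pushout-products with `j` against `e_{i,k}`. -/
lemma hasLiftingProperty_toSq [HasPullbacks V] [HasPushouts V] {X Y : C} (k : X ⟶ Y)
    {W W' : V} (s : W ⟶ W')
    (H : HasLiftingProperty
      (pushout.desc (f := j ▷ W) (g := U ◁ s) (U' ◁ s) (j ▷ W') (whisker_exchange j s).symm)
      (toSq V i k)) :
    HasLiftingProperty s (toSq V c k) := by
  rw [hasLiftingProperty_toSq_iff] at H ⊢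
  intro p q r h₁ h₂ h₃
  -- Transposing along `η`, `α` and `β` turns the problem for `s` into one for the pushout-product
  -- of `j` and `s`. The lift `L : U' ⊗ W' ⟶ C(B, X)` transposes back because `T` is a copower.
  obtain ⟨L, hL₁, hL₂, hL₃⟩ := H
    (pushout.desc (transpose h.η p) (transpose h.β q) (by
      rw [← transpose_comp_left, ← h.β_comp, ← transpose_whiskerRight_eq, h₁, transpose_comp]))
    (transpose h.α q) (transpose h.η r)
    (by
      apply pushout.hom_ext
      · rw [pushout.inl_desc_assoc, pushout.inl_desc_assoc, ← transpose_whiskerRight, ← h.α_comp,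
          ← transpose_whiskerRight_eq, h₁, transpose_comp]
      · rw [pushout.inr_desc_assoc, pushout.inr_desc_assoc, ← transpose_whiskerRight, ← h.comp_α,
          transpose_comp_left])
    (by
      apply pushout.hom_ext
      · rw [pushout.inl_desc_assoc, pushout.inl_desc_assoc, ← transpose_whiskerLeft, h₂,
          transpose_comp]
      · rw [pushout.inr_desc_assoc, pushout.inr_desc_assoc, ← transpose_whiskerLeft, h₃,
          transpose_whiskerRight_eq, h.β_comp, transpose_comp_left])
    (by
      rw [← transpose_whiskerLeft, h₃, transpose_whiskerRight_eq, h.α_comp,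
        transpose_whiskerRight])
  obtain ⟨l, rfl⟩ := (h.isCopower.bijective_transpose W' X).2 L
  dsimp only at hL₁ hL₂ hL₃
  refine ⟨l, (h.isCopower.bijective_transpose W X).1 ?_, h.ehom_ext ?_ ?_,
    (h.isCopower.bijective_transpose W' Y).1 ?_⟩
  · have := pushout.inl _ _ ≫= hL₁
    rw [pushout.inl_desc_assoc, pushout.inl_desc] at this
    dsimp only
    rw [transpose_comp, this]
  · rw [transpose_whiskerRight_eq, h.α_comp, transpose_whiskerRight, hL₂]
  · have := pushout.inr _ _ ≫= hL₁
    rw [pushout.inr_desc_assoc, pushout.inr_desc] at this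
    rw [transpose_whiskerRight_eq, h.β_comp, transpose_comp_left, this]
  · dsimp only
    rw [transpose_whiskerLeft, hL₃]

end CopowerCorner

/-- The copower of any object by `⊥_ V` is initial: elements `U ⟶ C(T, Z)` correspond to morphisms
out of `⊥_ V ⊗ U`, and after braiding to morphisms `⊥_ V ⟶ [U, C(A, Z)]`. -/
lemma isConicalInitial_of_isCopowered [SymmetricCategory V] [HasInitial V]
    (h : IsCopowered V C) [Nonempty C] : ∃ c : C, IsConicalInitial V c := by
  obtain ⟨A⟩ := ‹Nonempty C›
  obtain ⟨T, η, hη⟩ := h (⊥_ V) A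
  refine ⟨T, fun U Z => ⟨?_⟩⟩
  let e : (U ⟶ (T ⟶[V] Z)) ≃ (⊥_ V ⟶ (ihom U).obj (A ⟶[V] Z)) :=
    (Equiv.ofBijective _ (hη.bijective_transpose U Z)).trans
      (((β_ (⊥_ V) U).homFromEquiv).trans ((ihom.adjunction U).homEquiv _ _))
  exact e.unique

end Corners

/-! ### Smallness of the domains of pushout-products -/

section Presentable

variable {V : Type u} [Category.{v} V] [MonoidalCategory V]
  {C : Type u'} [Category.{v} C] [EnrichedOrdinaryCategory V C]

lemma IsEnrichedCardinalPresentable.of_le {X : C} {κ κ' : Cardinal.{v}} [Fact κ.IsRegular]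
    [Fact κ'.IsRegular] (h : IsEnrichedCardinalPresentable V X κ) (hκ : κ ≤ κ') :
    IsEnrichedCardinalPresentable V X κ' := fun J _ _ F c hc => by
  have := IsCardinalFiltered.of_le J hκ
  exact h J F c hc

lemma exists_isRegular_forall_le {ι : Type v} (κ : ι → Cardinal.{v}) :
    ∃ κ' : Cardinal.{v}, κ'.IsRegular ∧ ∀ i, κ i ≤ κ' :=
  ⟨Order.succ (max Cardinal.aleph0 (iSup κ)), Cardinal.isRegular_succ (le_max_left _ _),
    fun i => (le_ciSup Cardinal.bddAbove_of_small i).trans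
      ((le_max_right _ _).trans (Order.le_succ _))⟩

section

variable {κ : Cardinal.{v}} [Fact κ.IsRegular] {W : V} [IsCardinalPresentable W κ] {A : C}
  (hA : IsEnrichedCardinalPresentable V A κ) {J : Type v} [PartialOrder J]
  [IsCardinalFiltered J κ] {F : J ⥤ C} {c : Cocone F} (hc : IsConicalColimit V c)

include hA hc

/-- `C(A, -)` preserves the colimit, and then so does `V₀(W, -)` as `W` is presentable. -/
lemma IsEnrichedCardinalPresentable.exists_ehom (x : W ⟶ (A ⟶[V] c.pt)) :
    ∃ (j : J) (y : W ⟶ (A ⟶[V] F.obj j)), y ≫ eHomWhiskerLeft V A (c.ι.app j) = x := by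
  obtain ⟨hc'⟩ := hA J F c hc
  exact IsCardinalPresentable.exists_hom_of_isColimit κ hc' x

lemma IsEnrichedCardinalPresentable.exists_ehom_eq {j : J} (x y : W ⟶ (A ⟶[V] F.obj j))
    (h : x ≫ eHomWhiskerLeft V A (c.ι.app j) = y ≫ eHomWhiskerLeft V A (c.ι.app j)) :
    ∃ (k : J) (f : j ⟶ k),
      x ≫ eHomWhiskerLeft V A (F.map f) = y ≫ eHomWhiskerLeft V A (F.map f) := by
  obtain ⟨hc'⟩ := hA J F c hc
  exact IsCardinalPresentable.exists_eq_of_isColimit' κ hc' x y h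

end

/-- The domain of the pushout-product of a morphism between presentable objects and a morphism
between objects which are presentable in the enriched sense is presentable with respect to
colimits in the `V`-category `C`. -/
lemma CopowerCorner.nonempty_isColimit [MonoidalClosed V] {κ : Cardinal.{v}} [Fact κ.IsRegular]
    {U U' : V} {j : U ⟶ U'} {A B : C} {i : A ⟶ B} {P T : C} {c : P ⟶ T}
    (h : CopowerCorner j i c) [IsCardinalPresentable U κ] [IsCardinalPresentable U' κ]
    (hA : IsEnrichedCardinalPresentable V A κ) (hB : IsEnrichedCardinalPresentable V B κ)
    {J : Type v} [PartialOrder J] [IsCardinalFiltered J κ] {F : J ⥤ C} {t : Cocone F}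
    (ht : IsConicalColimit V t) :
    Nonempty (IsColimit ((coyoneda.obj (.op P)).mapCocone t)) := by
  have := isFiltered_of_isCardinalFiltered J κ
  refine ⟨Types.FilteredColimit.isColimitOf' _ _ (fun (f : P ⟶ t.pt) => ?_)
    (fun k (f : P ⟶ F.obj k) (g : P ⟶ F.obj k) (hfg : f ≫ t.ι.app k = g ≫ t.ι.app k) => ?_)⟩
  · obtain ⟨k₁, x, hx⟩ := hA.exists_ehom ht (h.α ≫ eHomWhiskerLeft V A f)
    obtain ⟨k₂, y, hy⟩ := hB.exists_ehom ht (h.β ≫ eHomWhiskerLeft V B f)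
    obtain ⟨k, a, b, -⟩ := IsFilteredOrEmpty.cocone_objs k₁ k₂
    -- The two components, each defined at some stage, agree on `U` and `A` only in the colimit;
    -- moving to a later stage `l` makes them agree there and hence define a morphism out of `P`.
    obtain ⟨l, d, hl⟩ := hA.exists_ehom_eq ht (j ≫ x ≫ eHomWhiskerLeft V A (F.map a))
      (y ≫ eHomWhiskerRight V i _ ≫ eHomWhiskerLeft V A (F.map b)) (by
        simp only [Category.assoc, ← eHomWhiskerLeft_comp, t.w, hx]
        rw [← eHom_whisker_exchange, reassoc_of% hy, reassoc_of% h.comp_α]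
        exact congrArg (h.β ≫ ·) (eHom_whisker_exchange V i f).symm)
    obtain ⟨g, hg₁, hg₂⟩ := h.exists_desc (x ≫ eHomWhiskerLeft V A (F.map (a ≫ d)))
      (y ≫ eHomWhiskerLeft V B (F.map (b ≫ d))) (by
        rw [Category.assoc, eHom_whisker_exchange]
        simpa using hl)
    refine ⟨l, g, h.hom_ext ?_ ?_⟩
    · dsimp
      rw [eHomWhiskerLeft_comp, reassoc_of% hg₁, ← eHomWhiskerLeft_comp, t.w, hx]
    · dsimp
      rw [eHomWhiskerLeft_comp, reassoc_of% hg₂, ← eHomWhiskerLeft_comp, t.w, hy]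
  · obtain ⟨k₁, a, ha⟩ := hA.exists_ehom_eq ht (h.α ≫ eHomWhiskerLeft V A f)
      (h.α ≫ eHomWhiskerLeft V A g) (by
        simp only [Category.assoc, ← eHomWhiskerLeft_comp, hfg])
    obtain ⟨k₂, b, hb⟩ := hB.exists_ehom_eq ht (h.β ≫ eHomWhiskerLeft V B f)
      (h.β ≫ eHomWhiskerLeft V B g) (by
        simp only [Category.assoc, ← eHomWhiskerLeft_comp, hfg])
    obtain ⟨l, d, e, -⟩ := IsFilteredOrEmpty.cocone_objs k₁ k₂
    refine ⟨l, a ≫ d, h.hom_ext ?_ ?_⟩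
    · have := ha =≫ eHomWhiskerLeft V A (F.map d)
      simpa using this
    · have := hb =≫ eHomWhiskerLeft V B (F.map e)
      rw [show a ≫ d = b ≫ e from Subsingleton.elim _ _]
      simpa using this

end Presentable

/-! ### The small object argument for pushout-products -/

section SmallObjectArgument

variable {V : Type u} [Category.{v} V] [MonoidalCategory V]
  {C : Type u'} [Category.{v} C] [EnrichedOrdinaryCategory V C]

/-- The formal triangle identity of the Galois connection between left and right classes. -/
lemma enrichedRlp_enrichedLlp_enrichedRlp [HasPullbacks V] (R : MorphismProperty V)
    (I : MorphismProperty C) :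
    enrichedRlp R (enrichedLlp R (enrichedRlp R I)) = enrichedRlp R I := by
  ext X Y k
  exact ⟨fun h A B f hf => h f fun _ _ k hk => hk f hf, fun h A B f hf => hf k h⟩

/-- The pushout-products of small families of morphisms between presentable objects permit the
small object argument. -/
lemma hasSmallObjectArgument_of_copowerCorner [MonoidalClosed V] [HasColimitsOfSize.{v, v} C]
    (hC : ∀ Z : C, PreservesLimitsOfSize.{v, v} (eYoneda V Z))
    {ι : Type v} {U U' : ι → V} {j : ∀ x, U x ⟶ U' x} {A B : ι → C} {i : ∀ x, A x ⟶ B x}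
    {P T : ι → C} {c : ∀ x, P x ⟶ T x} (h : ∀ x, CopowerCorner (j x) (i x) (c x))
    (hU : ∀ x, IsPresentable.{v} (U x)) (hU' : ∀ x, IsPresentable.{v} (U' x))
    (hA : ∀ x, IsEnrichedPresentable V (A x)) (hB : ∀ x, IsEnrichedPresentable V (B x)) :
    MorphismProperty.HasSmallObjectArgument.{v} (MorphismProperty.ofHoms c) := by
  choose κ₁ _ _ using fun x => (hU x).exists_cardinal
  choose κ₂ _ _ using fun x => (hU' x).exists_cardinal
  choose κ₃ _ hA using hA
  choose κ₄ _ hB using hB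
  -- One regular cardinal bounds all presentability ranks, as the family is small; chains of length
  -- `κ.ord` are then `κ`-directed.
  obtain ⟨κ, hκ, hle⟩ := exists_isRegular_forall_le fun x =>
    max (max (κ₁ x) (κ₂ x)) (max (κ₃ x) (κ₄ x))
  simp only [max_le_iff] at hle
  have : Fact κ.IsRegular := ⟨hκ⟩
  have : Nonempty κ.ord.ToType := Ordinal.nonempty_toType_iff.2 (by simpa using hκ.ne_zero)
  let := WellFoundedLT.toOrderBot κ.ord.ToType
  have : HasFiniteColimits C := hasFiniteColimits_of_hasColimitsOfSize C
  refine ⟨κ, inferInstance, inferInstance, ?_⟩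
  refine { preservesColimit := ?_ }
  rintro _ _ X Y _ ⟨x⟩ f hf
  have := isCardinalPresentable_of_le (U x) (hle x).1.1
  have := isCardinalPresentable_of_le (U' x) (hle x).1.2
  exact preservesColimit_of_preserves_colimit_cocone hf.isColimit
    ((h x).nonempty_isColimit (κ := κ) ((hA x).of_le (hle x).2.1) ((hB x).of_le (hle x).2.2)
      (isConicalColimit_of_isColimit hf.isColimit hC)).some

end SmallObjectArgument

end

end EnrichedSmallObject

/-! ### The enriched factorization -/

open EnrichedSmallObject
theorem mainTheorem1
    (V : Type u) [Category.{v} V] [MonoidalCategory V] [SymmetricCategory V] [MonoidalClosed V]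
    [HasLimits V] [HasColimits V]
    (K : Type u') [Category.{v} K] [EnrichedOrdinaryCategory V K]
    (hcopowers : IsCopowered V K)
    (hpushouts : HasConicalPushouts V K)
    (htransfinite : HasTransfiniteComposites V K)
    (I : MorphismProperty K) (hI : MorphismProperty.IsSmall.{v} I)
    (J : MorphismProperty V) (hJ : MorphismProperty.IsSmall.{v} J)
    (L R : MorphismProperty V)
    (hF : MorphismProperty.IsWeakFactorizationSystem L R)
    (hcofib : R = J.rlp)
    (hIpres : ∀ ⦃A B : K⦄ (f : A ⟶ B), I f →
      IsEnrichedPresentable V A ∧ IsEnrichedPresentable V B)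
    (hJpres : ∀ ⦃A B : V⦄ (f : A ⟶ B), J f → IsPresentable.{v} A ∧ IsPresentable.{v} B)
    (hcorners : StableUnderCorners L) :
    (∀ ⦃X Y : K⦄ (f : X ⟶ Y), ∃ (Z : K) (e : X ⟶ Z) (m : Z ⟶ Y),
      enrichedLlp R (enrichedRlp R I) e ∧ enrichedRlp R I m ∧ e ≫ m = f) ∧
    IsEnrichedWeakFactorizationSystem R
      (enrichedLlp R (enrichedRlp R I)) (enrichedRlp R I) := by
  suffices H : ∀ ⦃X Y : K⦄ (f : X ⟶ Y), ∃ (Z : K) (e : X ⟶ Z) (m : Z ⟶ Y),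
      enrichedLlp R (enrichedRlp R I) e ∧ enrichedRlp R I m ∧ e ≫ m = f from
    ⟨H, H, rfl, (enrichedRlp_enrichedLlp_enrichedRlp R I).symm⟩
  intro X Y f
  have : Nonempty K := ⟨X⟩
  obtain ⟨c₀, hc₀⟩ := isConicalInitial_of_isCopowered hcopowers
  have := hasColimits_of_conical hc₀ hpushouts htransfinite
  have hK := preservesLimits_eYoneda hc₀ hpushouts htransfinite
  have hJL : J ≤ L := by
    rw [← hF.llp, hcofib]
    exact J.le_llp_rlp
  obtain ⟨ι, A, B, i, rfl⟩ := (MorphismProperty.isSmall_iff_eq_ofHoms I).1 hI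
  obtain ⟨ι', U, U', j, rfl⟩ := (MorphismProperty.isSmall_iff_eq_ofHoms J).1 hJ
  choose P T c h using fun x : ι × ι' =>
    exists_copowerCorner hpushouts hcopowers (j x.2) (i x.1)
  replace h x := (h x).some
  subst hcofib
  -- Here cofibrant generation enters: membership in the right class of `F` is tested on the `j`
  -- alone.
  have hM_rlp : (MorphismProperty.ofHoms c).rlp =
      enrichedRlp (MorphismProperty.ofHoms j).rlp (MorphismProperty.ofHoms i) := by
    ext X Y k
    constructor
    · rintro hk _ _ _ ⟨a⟩ _ _ _ ⟨b⟩
      exact ((h (a, b)).hasLiftingProperty_iff k).1 (hk _ ⟨(a, b)⟩)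
    · rintro hk _ _ _ ⟨x⟩
      exact ((h x).hasLiftingProperty_iff k).2 (hk _ ⟨x.1⟩ _ ⟨x.2⟩)
  have := hasSmallObjectArgument_of_copowerCorner hK h
    (fun x => (hJpres _ ⟨x.2⟩).1) (fun x => (hJpres _ ⟨x.2⟩).2)
    (fun x => (hIpres _ ⟨x.1⟩).1) (fun x => (hIpres _ ⟨x.1⟩).2)
  have hM_llp := llp_rlp_le_enrichedLlp hK (MorphismProperty.ofHoms j)
    (MorphismProperty.ofHoms c)
    (enrichedRlp (MorphismProperty.ofHoms j).rlp (MorphismProperty.ofHoms i)) (by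
      rintro _ _ _ ⟨x⟩ X Y k hk W W' s hs
      refine (h x).hasLiftingProperty_toSq k s ?_
      -- The pushout-product of two generators lies in the left class of `F`, so it lifts against
      -- `e_{i,k}`, which is in the right class.
      have := hcorners (j x.2) s (hJL _ ⟨x.2⟩) (hJL _ hs)
      rw [← hF.llp] at this
      exact this _ (hk _ ⟨x.1⟩))
  let F := (MorphismProperty.factorizationData (MorphismProperty.ofHoms c).rlp.llp
    (MorphismProperty.ofHoms c).rlp f)
  exact ⟨F.Z, F.i, F.p, hM_llp _ F.hi, hM_rlp ▸ F.hp, F.fac⟩
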